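/- Let $1\le K'\le K$ and $N\ge 1$ be integers. **Model** (the $(K,K',N)$ hotplug model with scalar linear function retrieval and demand privacy against colluding users). A server holds $N$ files $F_1,\dots,F_N\in\mathbb F_q^{B}$ with independent uniform symbols. Each user $j\in[K]$ has local randomness $\tau_j$, known only to the server and to user $j$. The cache content $Z_j$ is a function of $(F_{[N]},\tau_j)$, fixed before the demands are known. Then an arbitrary set $\mathcal I\subseteq[K]$ of $K'$ users becomes active; user $j\in\mathcal I$ demands $\langle \mathbf d_j,F_{[N]}\rangle=\sum_n d_{j,n}F_n$ with $\mathbf d_j\in\mathbb F_q^N$. The server broadcasts a signal $X$, a function of $(\mathcal I,\mathbf d_{\mathcal I},F_{[N]},\tau_{[K]})$. The files, the $\tau_j$ and the $\mathbf d_j$ are all mutually independent, and the laws of the $\mathbf d_j$ are arbitrary. For all $\mathcal I$ and all laws of the demands it is required that $H(\langle \mathbf d_j,F_{[N]}\rangle\mid X,\mathbf d_j,Z_j)=0$ for all $j\in\mathcal I$ (the decoding map of user $j$ being the same for all $\mathcal I\ni j$), and that $I(\mathbf d_{\mathcal I\setminus\mathcal B};X,\mathbf d_{\mathcal B},Z_{\mathcal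 B}\mid F_{[N]})=0$ for all $\emptyset\ne\mathcal B\subseteq\mathcal I$. A pair $(M,R)$ is *achievable* if for every $\varepsilon>0$, for all sufficiently large $B$ and all sufficiently large prime powers $q$, there is such a scheme with at most $MB$ symbols of $\mathbb F_q$ in each cache and at most $(R+\varepsilon)B$ symbols in $X$. **Theorem.** For $t\in\{0,\dots,K'\}$ and $r'=\min(K',N)$ put $$M_t=\frac{N\binom{K-1}{t-1}+\left[\binom{K'}{t}-\binom{K-1}{t-1}\right]^+}{\binom{K'}{t}},\qquad R_t=\frac{\binom{K'}{t+1}-\binom{K'-r'}{t+1}}{\binom{K'}{t}},$$ where $\binom{a}{b}=0$ unless $a\ge b\ge 0$ and $[x]^+=\max(x,0)$. Then every point of the lower convex envelope of $(N,0)$ and the points $(M_t,R_t)$, $t\in\{0,\dots,K'\}$, is achievable. Moreover, the point $(M_t,R_t)$ is attained with subpacketization level $L_t=\binom{K'}{t}$: there are integers $h$ and $q_0$, depending only on $K,K',N,t$, such that over every finite field with at least $q_0$ elements there is a linear scheme that cuts each file into $L_t$ subfiles of equal length $m$, stores in each cache $M_tL_t$ linear combinations of subfiles and $h$ symbols not depending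 on the files, transmits $R_tL_t$ linear combinations of subfiles and $h$ symbols not depending on the files, and satisfies all the constraints above for every $m$, that is, for every file length $B=L_tm$. -/

import Mathlib

namespace Hotplug

/-! ### Shannon information measures on a finite probability space

`w : Ω → ℝ` is the probability mass function of the space. Logarithms are natural. -/

section Information

variable {Ω α β γ : Type} [Fintype Ω] [Fintype α] [Fintype β] [Fintype γ]

open Classical in
/-- The probability `P(X = x)`. -/
noncomputable def prob (w : Ω → ℝ) (X : Ω → α) (x : α) : ℝ :=
  ∑ ω : Ω, if X ω = x then w ω else 0

/-- The entropy `H(X)`. -/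
noncomputable def entropy (w : Ω → ℝ) (X : Ω → α) : ℝ :=
  ∑ x : α, Real.negMulLog (prob w X x)

/-- The conditional entropy `H(X | Y) = H(X, Y) - H(Y)`. -/
noncomputable def condEntropy (w : Ω → ℝ) (X : Ω → α) (Y : Ω → β) : ℝ :=
  entropy w (fun ω => (X ω, Y ω)) - entropy w Y

/-- The conditional mutual information `I(X ; Y | Z) = H(X | Z) - H(X | Y, Z)`. -/
noncomputable def condMutualInfo (w : Ω → ℝ) (X : Ω → α) (Y : Ω → β) (Z : Ω → γ) : ℝ :=
  condEntropy w X Z - condEntropy w X (fun ω => (Y ω, Z ω))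

end Information

/-! ### The hotplug model -/

/-- The library: `N` files, each a vector over `F` with coordinates indexed by `β`
(so that the file length is the cardinality of `β`). -/
abbrev Library (F : Type) (N : ℕ) (β : Type) : Type := Fin N → β → F

/-- The demands of the active users: a coefficient vector for each `j ∈ I`. -/
abbrev Demands (F : Type) {K : ℕ} (N : ℕ) (I : Finset (Fin K)) : Type := {j // j ∈ I} → Fin N → F

/-- The scalar linear combination `∑ n, d n • f n` of the files. -/
def linComb {F : Type} [Field F] {N : ℕ} {β : Type} (d : Fin N → F) (f : Library F N β) : β → F :=
  fun s => ∑ n, d n * f n s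

/-- A caching scheme for `K` users of which any `K'` may become active, and `N` files.
File symbols are indexed by `β`, cache symbols by `γ` and transmitted symbols by `ξ`.
User `j` has local randomness with finite alphabet `Rand j` and law `law j`. The cache of user `j`
is a function of the library and of its own randomness only (neither of the active set nor of the
demands); the delivery signal is a function of the active set, the active users' demands, the
library and all the local randomness. -/
structure Scheme (F : Type) (K K' N : ℕ) (β γ ξ : Type) where
  Rand : Fin K → Type
  randFintype : ∀ j, Fintype (Rand j)
  law : ∀ j, PMF (Rand j)
  cache : ∀ j, Library F N β → Rand j → γ → F
  transmit : ∀ I : Finset (Fin K), I.card = K' → Demands F N I → Library F N β →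
    (∀ j, Rand j) → ξ → F

namespace Scheme

attribute [instance] Scheme.randFintype

variable {F : Type} [Field F] [Fintype F] {K K' N : ℕ} {β γ ξ : Type}
  [Fintype β] [DecidableEq β] [Fintype γ] [DecidableEq γ] [Fintype ξ] [DecidableEq ξ]

/-- The sample space for the active set `I`: library, local randomness, demands. -/
abbrev Sample (S : Scheme F K K' N β γ ξ) (I : Finset (Fin K)) : Type :=
  Library F N β × (∀ j, S.Rand j) × Demands F N I

/-- The joint mass function: the symbols of the library are independent and uniform, user `j`'s
local randomness has law `S.law j`, the demand of active user `i` has law `Q i`, and all of these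
are independent. -/
noncomputable def mass (S : Scheme F K K' N β γ ξ) (I : Finset (Fin K))
    (Q : {j // j ∈ I} → PMF (Fin N → F)) (ω : S.Sample I) : ℝ :=
  (Fintype.card (Library F N β) : ℝ)⁻¹ * (∏ j, (S.law j (ω.2.1 j)).toReal) *
    ∏ i, (Q i (ω.2.2 i)).toReal

/-- The random variable `X`. -/
def signalRV (S : Scheme F K K' N β γ ξ) (I : Finset (Fin K)) (hI : I.card = K')
    (ω : S.Sample I) : ξ → F :=
  S.transmit I hI ω.2.2 ω.1 ω.2.1

/-- The random variable `Z_j`. -/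
def cacheRV (S : Scheme F K K' N β γ ξ) (I : Finset (Fin K)) (j : Fin K)
    (ω : S.Sample I) : γ → F :=
  S.cache j ω.1 (ω.2.1 j)

/-- Correct decoding, `H(⟨d_j, F⟩ | X, d_j, Z_j) = 0` for every active user `j`, for every active
set and all laws of the (independent) demands. -/
def DecodingConstraint (S : Scheme F K K' N β γ ξ) : Prop :=
  ∀ (I : Finset (Fin K)) (hI : I.card = K') (Q : {j // j ∈ I} → PMF (Fin N → F))
    (i : {j // j ∈ I}),
    condEntropy (S.mass I Q) (fun ω => linComb (ω.2.2 i) ω.1)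
      (fun ω => (S.signalRV I hI ω, ω.2.2 i, S.cacheRV I i.1 ω)) = 0

/-- A user decodes from `X`, its demand and its cache content alone: the same decoding map serves
for every active set that contains the user, so the identity of the other active users is not
side information. -/
def HasDecoders (S : Scheme F K K' N β γ ξ) : Prop :=
  ∃ dec : Fin K → (ξ → F) → (Fin N → F) → (γ → F) → (β → F),
    ∀ (I : Finset (Fin K)) (hI : I.card = K') (d : Demands F N I) (f : Library F N β)
      (τ : ∀ j, S.Rand j), (∀ j, S.law j (τ j) ≠ 0) → ∀ i : {j // j ∈ I},
      dec i.1 (S.transmit I hI d f τ) (d i) (S.cache i.1 f (τ i.1)) = linComb (d i) f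

/-- Demand privacy against colluding users, `I(d_{I∖A} ; X, d_A, Z_A | F) = 0` for every nonempty
set `A` of active users, for every active set and all laws of the (independent) demands. -/
def PrivacyConstraint (S : Scheme F K K' N β γ ξ) : Prop :=
  ∀ (I : Finset (Fin K)) (hI : I.card = K') (Q : {j // j ∈ I} → PMF (Fin N → F))
    (A : Finset {j // j ∈ I}), A.Nonempty →
    condMutualInfo (S.mass I Q)
      (fun ω => fun i : {i // i ∈ Aᶜ} => ω.2.2 i.1)
      (fun ω => (S.signalRV I hI ω, (fun i : {i // i ∈ A} => ω.2.2 i.1),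
        fun i : {i // i ∈ A} => S.cacheRV I i.1.1 ω))
      (fun ω => ω.1) = 0

/-- All constraints of the model. -/
def IsValid (S : Scheme F K K' N β γ ξ) : Prop :=
  S.DecodingConstraint ∧ S.HasDecoders ∧ S.PrivacyConstraint

end Scheme

/-- The memory-load pair `(M, R)` is achievable: for every `ε > 0`, for all large enough field
sizes and file lengths `B`, some valid scheme stores at most `M * B` symbols in each cache and
transmits at most `(R + ε) * B` symbols, whatever the active set and the demands.
That is, the upper limit of the optimal worst-case load with memory size `M`, as the file length
and the field size tend to infinity, is at most `R`. -/
def Achievable (K K' N : ℕ) (M R : ℝ) : Prop :=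
  ∀ ε : ℝ, 0 < ε → ∃ n₀ : ℕ, ∀ (F : Type) [Field F] [Fintype F], n₀ ≤ Fintype.card F →
    ∀ B : ℕ, n₀ ≤ B → ∃ (c x : ℕ) (S : Scheme F K K' N (Fin B) (Fin c) (Fin x)),
      (c : ℝ) ≤ M * B ∧ (x : ℝ) ≤ (R + ε) * B ∧ S.IsValid

/-! ### Subpacketization -/

/-- A linear scheme with subpacketization level `L`. Each file is cut into `L` subfiles of equal,
arbitrary length. A cache consists of `a` linear combinations of subfiles and `h` symbols that do
not depend on the files; a delivery signal consists of `b` linear combinations of subfiles and `h`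
symbols that do not depend on the files. None of the data depends on the length of the subfiles. -/
structure PacketScheme (F : Type) (K K' N L a b h : ℕ) where
  Rand : Fin K → Type
  randFintype : ∀ j, Fintype (Rand j)
  law : ∀ j, PMF (Rand j)
  cacheHead : ∀ j, Rand j → Fin h → F
  cacheCoef : ∀ j, Rand j → Fin a → Fin N → Fin L → F
  signalHead : ∀ I : Finset (Fin K), I.card = K' → Demands F N I → (∀ j, Rand j) → Fin h → F
  signalCoef : ∀ I : Finset (Fin K), I.card = K' → Demands F N I → (∀ j, Rand j) →
    Fin b → Fin N → Fin L → F

/-- Run a linear scheme with subpacketization level `L` on files of length `B = L * m`: the symbol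
`(l, s)` of a file is the symbol `s` of its subfile `l`. The caches hold `h + a * m` symbols
and the delivery signal `h + b * m` symbols. -/
def PacketScheme.toScheme {F : Type} [Field F] {K K' N L a b h : ℕ}
    (P : PacketScheme F K K' N L a b h) (m : ℕ) :
    Scheme F K K' N (Fin L × Fin m) (Fin h ⊕ Fin a × Fin m) (Fin h ⊕ Fin b × Fin m) where
  Rand := P.Rand
  randFintype := P.randFintype
  law := P.law
  cache j f r := Sum.elim (P.cacheHead j r)
    (fun k => ∑ n, ∑ l, P.cacheCoef j r k.1 n l * f n (l, k.2))
  transmit I hI d f τ := Sum.elim (P.signalHead I hI d τ)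
    (fun k => ∑ n, ∑ l, P.signalCoef I hI d τ k.1 n l * f n (l, k.2))

/-! ### The memory-load points -/

/-- `C(K - 1, t - 1)`, which is `0` for `t = 0`. -/
def choosePred (K t : ℕ) : ℕ := if t = 0 then 0 else (K - 1).choose (t - 1)

/-- The memory size `M_t`. -/
noncomputable def memNew (K K' N t : ℕ) : ℝ :=
  ((N : ℝ) * choosePred K t + max ((K'.choose t : ℝ) - choosePred K t) 0) / K'.choose t

/-- The load `R_t`. -/
noncomputable def loadNew (K' N t : ℕ) : ℝ :=
  ((K'.choose (t + 1) : ℝ) - (K' - min K' N).choose (t + 1)) / K'.choose t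

/-- The point `(N, 0)` and the points `(M_t, R_t)` for `0 ≤ t ≤ K'`. -/
def cornerPoints (K K' N : ℕ) : Set (ℝ × ℝ) :=
  {((N : ℝ), 0)} ∪ {p | ∃ t : ℕ, t ≤ K' ∧ p = (memNew K K' N t, loadNew K' N t)}

/-- The lower convex envelope of a set of points of the plane, as a function on the projection of
its convex hull to the first axis. -/
noncomputable def lowerConvexEnvelope (s : Set (ℝ × ℝ)) (x : ℝ) : ℝ :=
  sInf {y | (x, y) ∈ convexHull ℝ s}

end Hotplug

/-! Each user `j` caches a uniform key `p_j` in `F^N`, and the server serves the shifted demands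
`q_j = d_j + p_j`. The signal sees demands and keys only through `q`, so the keys of the users
outside a coalition act as one-time pads (`keyScheme_privacy`).

For decoding, each file is a polynomial of degree less than `L = C(K', t)`, its subfiles being the
coefficients. A coded subfile is attached to every `t`-subset `T` of `[K]`: the value at a node of
`T`. User `j` caches the values at all `T` containing `j`, for every file, plus enough further
values of `⟨p_j, F⟩` to interpolate it. Delivery gives an active user the values of `⟨q_j, F⟩` at
all `t`-subsets of the active set. These are `L` distinct nodes, so `⟨q_j, F⟩` is known, and
subtracting `⟨p_j, F⟩` leaves the demand (`exists_coded_delivery`).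

The load comes from a rank bound. The multicast signals are the values at the basis `e_S` of a
linear map on the exterior power `⋀^(t+1) F^I`, sending `v_0 ∧ ... ∧ v_t` to `∑ ± q(v_i) ⊗ c(v_0,
..., v_t without v_i)`. This map vanishes on `⋀^(t+1) (ker q)`, and `dim ker q ≥ K' - r'`. Hence its
range has dimension at most `C(K', t+1) - C(K'-r', t+1)` (`finrank_range_multicastMap_le`), and a
spanning family of that size is sent.

Convex combinations come from memory sharing with common keys (`achievable_of_convex_combination`).
-/

namespace Hotplug

/-! ### Entropy under functional dependence and independence -/

section Information

variable {Ω Ω₁ Ω₂ α β γ : Type} [Fintype Ω] [Fintype Ω₁] [Fintype Ω₂] [Fintype α] [Fintype β]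
  [Fintype γ]

theorem sum_prob (w : Ω → ℝ) (X : Ω → α) : ∑ x, prob w X x = ∑ ω, w ω := by
  classical
  unfold prob
  rw [Finset.sum_comm]
  simp

theorem condEntropy_eq_zero_of_comp (w : Ω → ℝ) {X : Ω → α} {Y : Ω → β} (g : β → α)
    (h : ∀ ω, X ω = g (Y ω)) : condEntropy w X Y = 0 := by
  classical
  have key : ∀ x y, prob w (fun ω => (X ω, Y ω)) (x, y) = if x = g y then prob w Y y else 0 := by
    intro x y
    unfold prob
    split_ifs with hx
    · refine Finset.sum_congr rfl fun ω _ => ?_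
      have : (X ω, Y ω) = (x, y) ↔ Y ω = y := by
        rw [Prod.mk.injEq]
        exact ⟨fun h' => h'.2, fun h' => ⟨by rw [h, h', hx], h'⟩⟩
      simp only [this]
    · refine Finset.sum_eq_zero fun ω _ => if_neg fun h' => hx ?_
      rw [Prod.mk.injEq] at h'
      rw [← h'.1, ← h'.2, h]
  unfold condEntropy entropy
  rw [Fintype.sum_prod_type_right, sub_eq_zero]
  refine Finset.sum_congr rfl fun y _ => ?_
  simp_rw [key, apply_ite Real.negMulLog, Real.negMulLog_zero]
  simp

omit [Fintype α] [Fintype β] in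
theorem prob_pair_of_product (e : Ω₁ × Ω₂ ≃ Ω) {w : Ω → ℝ} {w₁ : Ω₁ → ℝ} {w₂ : Ω₂ → ℝ}
    (hw : ∀ a b, w (e (a, b)) = w₁ a * w₂ b) {X : Ω → α} {Y : Ω → β} {X' : Ω₁ → α} {Y' : Ω₂ → β}
    (hX : ∀ a b, X (e (a, b)) = X' a) (hY : ∀ a b, Y (e (a, b)) = Y' b) (x : α) (y : β) :
    prob w (fun ω => (X ω, Y ω)) (x, y) = prob w₁ X' x * prob w₂ Y' y := by
  classical
  unfold prob
  rw [← e.sum_comp, Fintype.sum_prod_type, Finset.sum_mul_sum]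
  refine Finset.sum_congr rfl fun a _ => Finset.sum_congr rfl fun b _ => ?_
  simp only [hw, hX, hY, Prod.mk.injEq]
  split_ifs <;> simp_all

omit [Fintype β] in
theorem prob_snd_of_product (e : Ω₁ × Ω₂ ≃ Ω) {w : Ω → ℝ} {w₁ : Ω₁ → ℝ} {w₂ : Ω₂ → ℝ}
    (hw : ∀ a b, w (e (a, b)) = w₁ a * w₂ b) (h₁ : ∑ a, w₁ a = 1) {Y : Ω → β} {Y' : Ω₂ → β}
    (hY : ∀ a b, Y (e (a, b)) = Y' b) (y : β) : prob w Y y = prob w₂ Y' y := by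
  classical
  unfold prob
  rw [← e.sum_comp, Fintype.sum_prod_type_right]
  refine Finset.sum_congr rfl fun b _ => ?_
  simp only [hw, hY]
  split_ifs
  · rw [← Finset.sum_mul, h₁, one_mul]
  · simp

theorem condEntropy_of_product (e : Ω₁ × Ω₂ ≃ Ω) {w : Ω → ℝ} {w₁ : Ω₁ → ℝ} {w₂ : Ω₂ → ℝ}
    (hw : ∀ a b, w (e (a, b)) = w₁ a * w₂ b) (h₁ : ∑ a, w₁ a = 1) (h₂ : ∑ b, w₂ b = 1)
    {X : Ω → α} {Y : Ω → β} {X' : Ω₁ → α} {Y' : Ω₂ → β}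
    (hX : ∀ a b, X (e (a, b)) = X' a) (hY : ∀ a b, Y (e (a, b)) = Y' b) :
    condEntropy w X Y = entropy w₁ X' := by
  unfold condEntropy entropy
  simp_rw [Fintype.sum_prod_type, prob_pair_of_product e hw hX hY,
    prob_snd_of_product e hw h₁ hY, Real.negMulLog_mul, Finset.sum_add_distrib, ← Finset.mul_sum,
    ← Finset.sum_mul, sum_prob, h₁, h₂]
  ring_nf

/-- The two coordinates are independent, `X` lives on the first and `(Y, Z)` on the second, so both
conditional entropies equal the entropy of `X`. -/
theorem condMutualInfo_eq_zero_of_product (e : Ω₁ × Ω₂ ≃ Ω) {w : Ω → ℝ} {w₁ : Ω₁ → ℝ}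
    {w₂ : Ω₂ → ℝ} (hw : ∀ a b, w (e (a, b)) = w₁ a * w₂ b) (h₁ : ∑ a, w₁ a = 1)
    (h₂ : ∑ b, w₂ b = 1) {X : Ω → α} {Y : Ω → β} {Z : Ω → γ} {X' : Ω₁ → α} {Y' : Ω₂ → β}
    {Z' : Ω₂ → γ} (hX : ∀ a b, X (e (a, b)) = X' a) (hY : ∀ a b, Y (e (a, b)) = Y' b)
    (hZ : ∀ a b, Z (e (a, b)) = Z' b) : condMutualInfo w X Y Z = 0 := by
  unfold condMutualInfo
  rw [condEntropy_of_product e hw h₁ h₂ hX hZ,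
    condEntropy_of_product e hw h₁ h₂ (Y' := fun b => (Y' b, Z' b)) hX
      (fun a b => by rw [hY, hZ]), sub_self]

end Information

theorem sum_toReal_pmf {α : Type} [Fintype α] (p : PMF α) : ∑ a, (p a).toReal = 1 := by
  rw [← ENNReal.toReal_sum fun a _ => p.apply_ne_top a, ← tsum_fintype (L := .unconditional _),
    p.tsum_coe, ENNReal.toReal_one]

theorem sum_prod_toReal_pmf {ι : Type} [Fintype ι] [DecidableEq ι] {α : ι → Type}
    [∀ i, Fintype (α i)] (p : ∀ i, PMF (α i)) : ∑ a : ∀ i, α i, ∏ i, (p i (a i)).toReal = 1 := by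
  rw [← Fintype.prod_sum fun i a => (p i a).toReal]
  simp [sum_toReal_pmf]

/-! ### One-time pads on the demands, and privacy -/

section KeyScheme

variable {F : Type} [Field F] [Fintype F] {K K' N : ℕ} {β γ ξ : Type}

/-- A scheme in which the local randomness of user `j` is a uniform vector `p j` (the key), and the
signal depends on the demands and on the keys through `d j + p j` only. -/
noncomputable def keyScheme (cache : Fin K → (Fin N → F) → Library F N β → γ → F)
    (transmit : ∀ I : Finset (Fin K), I.card = K' → Demands F N I → Library F N β → ξ → F) :
    Scheme F K K' N β γ ξ where
  Rand := fun _ => Fin N → F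
  randFintype := fun _ => inferInstance
  law := fun _ => PMF.uniformOfFintype (Fin N → F)
  cache := fun j f r => cache j r f
  transmit := fun I hI d f τ => transmit I hI (fun i => d i + τ i.1) f

variable [Fintype β] [DecidableEq β] [Fintype γ] [DecidableEq γ] [Fintype ξ] [DecidableEq ξ]
  (cache : Fin K → (Fin N → F) → Library F N β → γ → F)
  (transmit : ∀ I : Finset (Fin K), I.card = K' → Demands F N I → Library F N β → ξ → F)

open Classical in
/-- The demands with given restrictions to a set of users and to its complement. -/
noncomputable def mergeDemands {I : Finset (Fin K)} (A : Finset {j // j ∈ I})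
    (a : {i // i ∈ Aᶜ} → Fin N → F) (b : {i // i ∈ A} → Fin N → F) : Demands F N I :=
  fun i => if h : i ∈ A then b ⟨i, h⟩ else a ⟨i, Finset.mem_compl.2 h⟩

open Classical in
/-- The demands of the users outside `A`, set to zero at all other users. -/
noncomputable def maskDemands {I : Finset (Fin K)} (A : Finset {j // j ∈ I})
    (a : {i // i ∈ Aᶜ} → Fin N → F) (j : Fin K) : Fin N → F :=
  if h : ∃ hj : j ∈ I, (⟨j, hj⟩ : {j // j ∈ I}) ∈ Aᶜ then a ⟨⟨j, h.1⟩, h.2⟩ else 0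

omit [Fintype F] in
theorem maskDemands_of_mem {I : Finset (Fin K)} (A : Finset {j // j ∈ I})
    (a : {i // i ∈ Aᶜ} → Fin N → F) {i : {j // j ∈ I}} (hi : i ∈ A) :
    maskDemands A a i.1 = 0 :=
  dif_neg fun h => Finset.mem_compl.1 h.2 hi

omit [Field F] [Fintype F] in
theorem mergeDemands_of_mem {I : Finset (Fin K)} (A : Finset {j // j ∈ I})
    (a : {i // i ∈ Aᶜ} → Fin N → F) (b : {i // i ∈ A} → Fin N → F) (i : {i // i ∈ A}) :
    mergeDemands A a b i.1 = b i :=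
  dif_pos i.2

omit [Field F] [Fintype F] in
theorem mergeDemands_of_mem_compl {I : Finset (Fin K)} (A : Finset {j // j ∈ I})
    (a : {i // i ∈ Aᶜ} → Fin N → F) (b : {i // i ∈ A} → Fin N → F) (i : {i // i ∈ Aᶜ}) :
    mergeDemands A a b i.1 = a i :=
  dif_neg (Finset.mem_compl.1 i.2)

/-- Coordinates on the sample space in which the demands outside `A` and the pair of the signal and
the view of the users in `A` depend on different coordinates. -/
noncomputable def sampleEquiv (β : Type) (I : Finset (Fin K)) (A : Finset {j // j ∈ I}) :
    ({i // i ∈ Aᶜ} → Fin N → F) ×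
      (Library F N β × (Fin K → Fin N → F) × ({i // i ∈ A} → Fin N → F)) ≃
    Library F N β × (Fin K → Fin N → F) × Demands F N I where
  -- The coordinate `x.2.2.1` is the shifted demand at active users outside `A` and the key at all
  -- other users.
  toFun x := (x.2.1, x.2.2.1 - maskDemands A x.1, mergeDemands A x.1 x.2.2.2)
  invFun ω := (fun i => ω.2.2 i.1, ω.1, ω.2.1 + maskDemands A (fun i => ω.2.2 i.1),
    fun i => ω.2.2 i.1)
  left_inv := by
    rintro ⟨a, f, σ, b⟩
    simp only [mergeDemands_of_mem, mergeDemands_of_mem_compl, sub_add_cancel]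
  right_inv := by
    rintro ⟨f, τ, d⟩
    have h : mergeDemands A (fun i : {i // i ∈ Aᶜ} => d i.1) (fun i => d i.1) = d := by
      funext i
      unfold mergeDemands
      split_ifs <;> rfl
    simp only [h, add_sub_cancel_right]

omit [DecidableEq γ] [Fintype γ] [Fintype ξ] [DecidableEq ξ] in
theorem keyScheme_mass (I : Finset (Fin K)) (Q : {j // j ∈ I} → PMF (Fin N → F))
    (f : Library F N β) (τ : Fin K → Fin N → F) (d : Demands F N I) :
    (keyScheme cache transmit).mass I Q (f, τ, d) = (Fintype.card (Library F N β) : ℝ)⁻¹ *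
      ((Fintype.card (Fin N → F) : ℝ)⁻¹) ^ K * ∏ i, (Q i (d i)).toReal := by
  have h : ∀ j, ((keyScheme cache transmit).law j (τ j)).toReal =
      (Fintype.card (Fin N → F) : ℝ)⁻¹ := fun j => by
    change (PMF.uniformOfFintype (Fin N → F) (τ j)).toReal = _
    rw [PMF.uniformOfFintype_apply, ENNReal.toReal_inv, ENNReal.toReal_natCast]
  simp only [Scheme.mass, h, Finset.prod_const, Finset.card_univ, Fintype.card_fin]

/-- In the coordinates of `sampleEquiv`, signal and caches of `A` no longer involve the demands
outside `A`. The keys being uniform, translating them preserves their law and the mass function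
factors. -/
theorem keyScheme_privacy : (keyScheme cache transmit).PrivacyConstraint := by
  classical
  intro I hI Q A _
  refine condMutualInfo_eq_zero_of_product (sampleEquiv β I A)
    (w₁ := fun a => ∏ i, (Q i.1 (a i)).toReal)
    (w₂ := fun y => (Fintype.card (Library F N β) : ℝ)⁻¹ *
      ((Fintype.card (Fin N → F) : ℝ)⁻¹) ^ K * ∏ i, (Q i.1 (y.2.2 i)).toReal)
    (X' := id)
    (Y' := fun y => (transmit I hI
        (fun i => (if h : i ∈ A then y.2.2 ⟨i, h⟩ else 0) + y.2.1 i.1) y.1, y.2.2,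
        fun i => cache i.1.1 (y.2.1 i.1.1) y.1))
    (Z' := fun y => y.1) ?_ ?_ ?_ ?_ ?_ ?_
  · rintro a ⟨f, σ, b⟩
    have h : ∏ i, (Q i (mergeDemands A a b i)).toReal =
        (∏ i : {i // i ∈ A}, (Q i.1 (b i)).toReal) *
          ∏ i : {i // i ∈ Aᶜ}, (Q i.1 (a i)).toReal := by
      rw [← Finset.prod_mul_prod_compl A, ← Finset.prod_coe_sort A, ← Finset.prod_coe_sort Aᶜ]
      simp only [mergeDemands_of_mem, mergeDemands_of_mem_compl]
    refine (keyScheme_mass cache transmit I Q f (σ - maskDemands A a) (mergeDemands A a b)).trans ?_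
    rw [h]
    ring
  · exact sum_prod_toReal_pmf fun i : {i // i ∈ Aᶜ} => Q i.1
  · have h₁ : (Fintype.card (Library F N β) : ℝ) ≠ 0 := Nat.cast_ne_zero.2 Fintype.card_ne_zero
    have h₂ : (Fintype.card (Fin N → F) : ℝ) ≠ 0 := Nat.cast_ne_zero.2 Fintype.card_ne_zero
    simp only [Fintype.sum_prod_type, ← Finset.mul_sum, Finset.sum_const, Finset.card_univ,
      sum_prod_toReal_pmf fun i : {i // i ∈ A} => Q i.1, nsmul_eq_mul]
    rw [Fintype.card_fun (α := Fin K), Fintype.card_fin]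
    push_cast
    have h₃ := pow_ne_zero K h₂
    rw [mul_one, inv_pow]
    field_simp
  · rintro a ⟨f, σ, b⟩
    exact funext fun i => mergeDemands_of_mem_compl A a b i
  · rintro a ⟨f, σ, b⟩
    refine Prod.ext ?_ (Prod.ext ?_ ?_)
    · change transmit I hI (fun i => mergeDemands A a b i + (σ i.1 - maskDemands A a i.1)) f = _
      congr 1
      funext i
      by_cases h : i ∈ A
      · rw [mergeDemands_of_mem A a b ⟨i, h⟩, maskDemands_of_mem A a h, dif_pos h, sub_zero]
      · have : maskDemands A a i.1 = a ⟨i, Finset.mem_compl.2 h⟩ :=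
          dif_pos ⟨i.2, Finset.mem_compl.2 h⟩
        rw [mergeDemands_of_mem_compl A a b ⟨i, Finset.mem_compl.2 h⟩, this, dif_neg h]
        abel
    · exact funext fun i => mergeDemands_of_mem A a b i
    · funext i
      change cache i.1.1 (σ i.1.1 - maskDemands A a i.1.1) f = _
      rw [maskDemands_of_mem A a i.2, sub_zero]
  · rintro a ⟨f, σ, b⟩
    rfl

theorem keyScheme_isValid (dec : Fin K → (ξ → F) → (Fin N → F) → (γ → F) → β → F)
    (hdec : ∀ (I : Finset (Fin K)) (hI : I.card = K') (q : Demands F N I) (f : Library F N β)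
      (i : {j // j ∈ I}) (d : Fin N → F),
      dec i.1 (transmit I hI q f) d (cache i.1 (q i - d) f) = linComb d f) :
    (keyScheme cache transmit).IsValid := by
  have key : ∀ (I : Finset (Fin K)) (hI : I.card = K') (d : Demands F N I) (f : Library F N β)
      (τ : ∀ _ : Fin K, Fin N → F) (i : {j // j ∈ I}),
      dec i.1 (transmit I hI (fun i => d i + τ i.1) f) (d i) (cache i.1 (τ i.1) f) =
        linComb (d i) f := by
    intro I hI d f τ i
    have := hdec I hI (fun i => d i + τ i.1) f i (d i)
    rwa [add_sub_cancel_left] at this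
  refine ⟨?_, ⟨dec, fun I hI d f τ _ i => key I hI d f τ i⟩, keyScheme_privacy cache transmit⟩
  intro I hI Q i
  exact condEntropy_eq_zero_of_comp _ (fun y => dec i.1 y.1 y.2.1 y.2.2)
    fun ω => (key I hI ω.2.2 ω.1 ω.2.1 i).symm

end KeyScheme

/-! ### Multicast signals and their rank, via exterior powers -/

section Multicast

variable {F : Type} [Field F]

/-- A polynomial of degree less than `L` with at least `L` distinct zeros vanishes: the MDS property
of the coded subfiles. -/
theorem eq_zero_of_forall_sum_pow_mul_eq_zero {κ : Type} [Fintype κ] {L : ℕ} {x : κ → F}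
    (hx : Function.Injective x) (hL : L ≤ Fintype.card κ) (v : Fin L → F)
    (h : ∀ k, ∑ l : Fin L, x k ^ (l : ℕ) * v l = 0) : v = 0 := by
  obtain ⟨e⟩ : Nonempty (Fin L ↪ κ) := Function.Embedding.nonempty_of_card_le (by simpa using hL)
  refine Matrix.eq_zero_of_forall_index_sum_mul_pow_eq_zero (hx.comp e.injective) fun j => ?_
  rw [← h (e j)]
  exact Finset.sum_congr rfl fun l _ => mul_comm _ _

/-- Padding a basis with zeros makes the number of transmitted combinations independent of the rank
of the demands. -/
theorem exists_fin_span_eq {M : Type} [AddCommGroup M] [Module F M] [Module.Finite F M]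
    (S : Submodule F M) {b : ℕ} (hb : Module.finrank F S ≤ b) :
    ∃ s : Fin b → M, Submodule.span F (Set.range s) = S := by
  let B := Module.finBasis F S
  refine ⟨fun k => if h : (k : ℕ) < Module.finrank F S then (B ⟨k, h⟩ : M) else 0,
    le_antisymm (Submodule.span_le.2 ?_) ?_⟩
  · rintro _ ⟨k, rfl⟩
    dsimp only
    split_ifs
    · exact (B _).2
    · exact S.zero_mem
  · have h : S = Submodule.span F (Set.range (S.subtype ∘ B)) := by
      rw [Set.range_comp, Submodule.span_image, B.span_eq, Submodule.map_top,
        Submodule.range_subtype]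
    conv_lhs => rw [h]
    refine Submodule.span_mono ?_
    rintro _ ⟨k, rfl⟩
    exact ⟨⟨k, k.2.trans_le hb⟩, dif_pos k.2⟩

variable {ι : Type} [Fintype ι] [LinearOrder ι] {N L t : ℕ}

/-- The alternating map with value `c T` at the basis vectors of the elements of `T` in
increasing order. -/
noncomputable def subsetAlternating (t : ℕ) (c : Finset ι → Fin L → F) :
    (ι → F) [⋀^Fin t]→ₗ[F] (Fin L → F) :=
  ∑ T : {T : Finset ι // T.card = t}, (LinearMap.toSpanSingleton F _ (c T.1)).compAlternatingMap
    (Matrix.detRowAlternating.compLinearMap (LinearMap.funLeft F F (T.1.orderEmbOfFin T.2)))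

theorem subsetAlternating_apply (c : Finset ι → Fin L → F) (w : Fin t → ι → F) :
    subsetAlternating t c w = ∑ T : {T : Finset ι // T.card = t},
      (Matrix.of fun a k => w a (T.1.orderEmbOfFin T.2 k)).det • c T.1 := by
  let ev : ((ι → F) [⋀^Fin t]→ₗ[F] (Fin L → F)) →+ (Fin L → F) :=
    { toFun := fun m => m w, map_zero' := rfl, map_add' := fun _ _ => rfl }
  exact map_sum ev _ _

/-- If `i ∉ T`, the row of `e_i` in the minor at `T` is zero, so only the `c T` with `i ∈ T`
contribute. -/
theorem subsetAlternating_sum_eq_zero (c : Finset ι → Fin L → F) (w : Fin t → ι → F) (i : ι)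
    (a : Fin t) (ha : w a = Pi.single i 1) (g : Fin L → F)
    (hg : ∀ T : Finset ι, T.card = t → i ∈ T → ∑ l, c T l * g l = 0) :
    ∑ l, subsetAlternating t c w l * g l = 0 := by
  simp only [subsetAlternating_apply, Finset.sum_apply, Finset.sum_mul, Pi.smul_apply, smul_eq_mul,
    mul_assoc]
  rw [Finset.sum_comm]
  refine Finset.sum_eq_zero fun T _ => ?_
  rw [← Finset.mul_sum]
  by_cases hi : i ∈ T.1
  · rw [hg T.1 T.2 hi, mul_zero]
  · rw [Matrix.det_eq_zero_of_row_eq_zero a, zero_mul]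
    intro k
    rw [Matrix.of_apply, ha]
    exact Pi.single_eq_of_ne (fun h => hi (by rw [← h]; exact T.1.orderEmbOfFin_mem T.2 k)) _

theorem subsetAlternating_basis (c : Finset ι → Fin L → F) (T : Finset ι) (hT : T.card = t) :
    subsetAlternating t c (fun a => Pi.single (T.orderEmbOfFin hT a) (1 : F)) = c T := by
  rw [subsetAlternating_apply, Fintype.sum_eq_single ⟨T, hT⟩]
  · have : (Matrix.of fun a k => (Pi.single (T.orderEmbOfFin hT a) (1 : F) : ι → F)
        (T.orderEmbOfFin hT k)) = 1 := by
      ext a k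
      simp [Matrix.one_apply, Pi.single_apply, eq_comm]
    rw [this, Matrix.det_one, one_smul]
  · rintro ⟨T', hT'⟩ hne
    obtain ⟨x, hx, hx'⟩ : ∃ x ∈ T, x ∉ T' := by
      by_contra! h
      exact hne (Subtype.ext (Finset.eq_of_subset_of_card_le h (by rw [hT, hT'])).symm)
    obtain ⟨a, rfl⟩ : x ∈ Set.range (T.orderEmbOfFin hT) := by
      rw [Finset.range_orderEmbOfFin]; exact hx
    rw [Matrix.det_eq_zero_of_row_eq_zero a, zero_smul]
    intro k
    rw [Matrix.of_apply]
    exact Pi.single_eq_of_ne (fun h => hx' (by rw [← h]; exact T'.orderEmbOfFin_mem hT' k)) _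

/-- The linear map that sends the `i`-th basis vector to `q i`. -/
noncomputable def demandMap (q : ι → Fin N → F) : (ι → F) →ₗ[F] (Fin N → F) :=
  Fintype.linearCombination F q

/-- The bilinear map behind the multicast signals: one factor is a combination of the demands, the
other one a combination of the coding vectors. -/
noncomputable def multicastBilin (t : ℕ) (c : Finset ι → Fin L → F) (q : ι → Fin N → F) :
    (ι → F) →ₗ[F] (ι → F) [⋀^Fin t]→ₗ[F] (Fin N → Fin L → F) where
  toFun v := (LinearMap.pi fun n => demandMap q v n • LinearMap.id).compAlternatingMap
    (subsetAlternating t c)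
  map_add' v v' := by
    ext w n l
    simp [add_mul]
  map_smul' r v := by
    ext w n l
    simp [mul_assoc]

theorem multicastBilin_apply (c : Finset ι → Fin L → F) (q : ι → Fin N → F) (v : ι → F)
    (w : Fin t → ι → F) (n : Fin N) (l : Fin L) :
    multicastBilin t c q v w n l = demandMap q v n * subsetAlternating t c w l := rfl

/-- The linear map whose values at the basis of the exterior power are the multicast signals. -/
noncomputable def multicastMap (t : ℕ) (c : Finset ι → Fin L → F) (q : ι → Fin N → F) :
    ⋀[F]^(t + 1) (ι → F) →ₗ[F] (Fin N → Fin L → F) :=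
  exteriorPower.alternatingMapLinearEquiv
    (AlternatingMap.alternatizeUncurryFin (multicastBilin t c q))

theorem multicastMap_ιMulti (c : Finset ι → Fin L → F) (q : ι → Fin N → F)
    (v : Fin (t + 1) → ι → F) :
    multicastMap t c q (exteriorPower.ιMulti F (t + 1) v) =
      ∑ i : Fin (t + 1), (-1) ^ (i : ℕ) • multicastBilin t c q (v i) (Fin.removeNth i v) := by
  rw [multicastMap, exteriorPower.alternatingMapLinearEquiv_apply_ιMulti,
    AlternatingMap.alternatizeUncurryFin_apply]

theorem finrank_range_multicastMap_le (c : Finset ι → Fin L → F) (q : ι → Fin N → F) :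
    Module.finrank F (LinearMap.range (multicastMap t c q)) ≤ (Fintype.card ι).choose (t + 1) -
      (Fintype.card ι - min (Fintype.card ι) N).choose (t + 1) := by
  set E := LinearMap.ker (demandMap q)
  -- Rank-nullity: the rank of `demandMap q` is at most `N`.
  have hE : Fintype.card ι - min (Fintype.card ι) N ≤ Module.finrank F E := by
    have h₁ := LinearMap.finrank_range_add_finrank_ker (demandMap q)
    have h₂ := Submodule.finrank_le (LinearMap.range (demandMap q))
    simp only [Module.finrank_fintype_fun_eq_card, Fintype.card_fin] at h₁ h₂
    change _ + Module.finrank F E = _ at h₁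
    omega
  -- On wedges of vectors of `E`, each summand has a factor `demandMap q (v i) = 0`.
  have hcomp : multicastMap t c q ∘ₗ exteriorPower.map (t + 1) E.subtype = 0 := by
    refine exteriorPower.linearMap_ext ?_
    ext v : 1
    simp only [LinearMap.compAlternatingMap_apply, LinearMap.comp_apply,
      exteriorPower.map_apply_ιMulti, multicastMap_ιMulti, LinearMap.zero_apply]
    refine Finset.sum_eq_zero fun i _ => ?_
    have h0 : multicastBilin t c q ((E.subtype ∘ v) i)
        (Fin.removeNth i (E.subtype ∘ v)) = 0 := by
      ext n l
      rw [multicastBilin_apply, show demandMap q ((E.subtype ∘ v) i) = 0 from (v i).2]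
      simp
    rw [h0, smul_zero]
  have hker : Module.finrank F (⋀[F]^(t + 1) E) ≤
      Module.finrank F (LinearMap.ker (multicastMap t c q)) :=
    LinearMap.finrank_le_finrank_of_injective
      (f := (exteriorPower.map (t + 1) E.subtype).codRestrict _
        fun x => LinearMap.congr_fun hcomp x)
      ((LinearMap.injective_codRestrict_iff _).2
        (exteriorPower.map_injective_field E.injective_subtype))
  rw [exteriorPower.finrank_eq] at hker
  have h₃ := LinearMap.finrank_range_add_finrank_ker (multicastMap t c q)
  rw [exteriorPower.finrank_eq, Module.finrank_fintype_fun_eq_card] at h₃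
  have h₄ := Nat.choose_le_choose (t + 1) hE
  omega

/-- The multicast signals of all sets of `t + 1` users are spanned by few of them. A user that
knows the coded subfiles of the sets containing it recovers the coded subfiles of its demand. -/
theorem exists_multicast (t : ℕ) (c : Finset ι → Fin L → F) (q : ι → Fin N → F) :
    ∃ s : Fin ((Fintype.card ι).choose (t + 1) -
        (Fintype.card ι - min (Fintype.card ι) N).choose (t + 1)) → Fin N → Fin L → F,
      ∀ (f : Library F N (Fin L)) (i : ι), (∀ k, ∑ n, ∑ l, s k n l * f n l = 0) →
        (∀ T : Finset ι, T.card = t → i ∈ T → ∀ n, ∑ l, c T l * f n l = 0) →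
        ∀ T : Finset ι, T.card = t → ∑ l, c T l * linComb (q i) f l = 0 := by
  obtain ⟨s, hs⟩ := exists_fin_span_eq _ (finrank_range_multicastMap_le (t := t) c q)
  refine ⟨s, fun f i hsf hcf T hT => ?_⟩
  let φ : (Fin N → Fin L → F) →ₗ[F] F :=
    ∑ n, ∑ l, f n l • ((LinearMap.proj l : (Fin L → F) →ₗ[F] F) ∘ₗ LinearMap.proj n)
  have hφ : ∀ x, φ x = ∑ n, ∑ l, x n l * f n l := fun x => by
    simp [φ, mul_comm]
  have hrange : LinearMap.range (multicastMap t c q) ≤ LinearMap.ker φ := by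
    rw [← hs, Submodule.span_le]
    rintro _ ⟨k, rfl⟩
    exact (hφ _).trans (hsf k)
  have hbilin : ∀ v w, φ (multicastBilin t c q v w) =
      ∑ l, subsetAlternating t c w l * linComb (demandMap q v) f l := by
    intro v w
    rw [hφ, Finset.sum_comm]
    refine Finset.sum_congr rfl fun l _ => ?_
    rw [linComb, Finset.mul_sum]
    refine Finset.sum_congr rfl fun n _ => ?_
    rw [multicastBilin_apply]
    ring
  have hcomb : ∀ d : Fin N → F, ∀ T : Finset ι, T.card = t → i ∈ T →
      ∑ l, c T l * linComb d f l = 0 := by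
    intro d T hT hi
    simp only [linComb, Finset.mul_sum]
    rw [Finset.sum_comm]
    refine Finset.sum_eq_zero fun n _ => ?_
    rw [← mul_zero (d n), ← hcf T hT hi n, Finset.mul_sum]
    exact Finset.sum_congr rfl fun l _ => by ring
  -- Evaluate at `e_i ∧ e_T`. The leading term is the wanted `q i ⊗ c T`; every other term keeps
  -- `e_i` as an argument of the alternating factor and so involves only coded subfiles known to
  -- user `i`. The case `i ∈ T` needs no separate treatment.
  let u : Fin t → ι → F := fun a => Pi.single (T.orderEmbOfFin hT a) 1
  let v : Fin (t + 1) → ι → F := Fin.cons (Pi.single i 1) u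
  have hv : φ (multicastMap t c q (exteriorPower.ιMulti F (t + 1) v)) = 0 :=
    hrange (LinearMap.mem_range_self _ _)
  rw [multicastMap_ιMulti, map_sum, Fin.sum_univ_succ, Finset.sum_eq_zero, add_zero] at hv
  · have h0 : Fin.removeNth 0 v = u := by
      rw [Fin.removeNth_zero]; rfl
    have hq : demandMap q (Pi.single i 1) = q i := by
      rw [demandMap, Fintype.linearCombination_apply_single, one_smul]
    rw [Fin.val_zero, pow_zero, one_smul, h0, hbilin, subsetAlternating_basis] at hv
    rwa [show v 0 = Pi.single i 1 from rfl, hq] at hv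
  · intro k _
    rw [map_zsmul, hbilin]
    -- An index `k` in `Fin t` forces `t > 0`; removing a later entry leaves `e_i` at position `0`.
    obtain ⟨t, rfl⟩ : ∃ t', t = t' + 1 := ⟨t - 1, by have := k.2; omega⟩
    rw [subsetAlternating_sum_eq_zero c _ i 0 ?_ _ (hcomb _), smul_zero]
    simp [Fin.removeNth, v]

end Multicast

/-! ### Coded placement and delivery at a corner point -/

/-- A linear delivery scheme in which the cache content of a user is determined by a key, and the
signal by the demands shifted by the keys. A user whose cached and received combinations all vanish
on a library has a vanishing demand, shifted demand minus key. -/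
structure LinearDelivery (F : Type) [Field F] (K K' N : ℕ) (β γ ξ : Type) [Fintype β] where
  cacheCoef : Fin K → (Fin N → F) → γ → Fin N → β → F
  signalCoef : ∀ I : Finset (Fin K), I.card = K' → Demands F N I → ξ → Fin N → β → F
  decodable : ∀ (I : Finset (Fin K)) (hI : I.card = K') (q : Demands F N I) (i : {j // j ∈ I})
    (p : Fin N → F) (f : Library F N β),
    (∀ k, ∑ n, ∑ l, cacheCoef i.1 p k n l * f n l = 0) →
    (∀ k, ∑ n, ∑ l, signalCoef I hI q k n l * f n l = 0) → linComb (q i - p) f = 0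

theorem card_powersetCard_mem (K t : ℕ) (j : Fin K) :
    Fintype.card {T : Finset (Fin K) // T.card = t ∧ j ∈ T} = choosePred K t := by
  rw [Fintype.card_subtype]
  unfold choosePred
  split_ifs with ht
  · rw [Finset.card_eq_zero, Finset.filter_eq_empty_iff]
    rintro T - ⟨h₁, h₂⟩
    rw [ht, Finset.card_eq_zero] at h₁
    simp [h₁] at h₂
  · have h : (Finset.univ.erase j).card = K - 1 := by simp
    rw [← h, ← Finset.card_powersetCard]
    refine Finset.card_bij' (fun T _ => T.erase j) (fun T _ => insert j T) ?_ ?_ ?_ ?_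
    · intro T hT
      simp only [Finset.mem_filter, Finset.mem_univ, true_and] at hT
      rw [Finset.mem_powersetCard, Finset.card_erase_of_mem hT.2, hT.1]
      exact ⟨Finset.erase_subset_erase _ (Finset.subset_univ _), rfl⟩
    · intro T hT
      rw [Finset.mem_powersetCard] at hT
      have hj : j ∉ T := fun h => Finset.notMem_erase j _ (hT.1 h)
      simp only [Finset.mem_filter, Finset.mem_univ, true_and]
      rw [Finset.card_insert_of_notMem hj, hT.2]
      exact ⟨by omega, Finset.mem_insert_self _ _⟩
    · intro T hT
      simp only [Finset.mem_filter, Finset.mem_univ, true_and] at hT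
      exact Finset.insert_erase hT.2
    · intro T hT
      rw [Finset.mem_powersetCard] at hT
      exact Finset.erase_insert fun h => Finset.notMem_erase j _ (hT.1 h)

/-- The number of cached combinations of subfiles. -/
def cacheSize (K K' N t : ℕ) : ℕ := N * choosePred K t + (K'.choose t - choosePred K t)

/-- The number of transmitted combinations of subfiles. -/
def signalSize (K' N t : ℕ) : ℕ := K'.choose (t + 1) - (K' - min K' N).choose (t + 1)

theorem linComb_sub {F : Type} [Field F] {N : ℕ} {β : Type} (d d' : Fin N → F)
    (f : Library F N β) : linComb (d - d') f = linComb d f - linComb d' f := by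
  funext s
  simp [linComb, sub_mul]

theorem exists_coded_delivery (F : Type) [Field F] [Fintype F] {K K' : ℕ} (N t : ℕ)
    (hF : 2 ^ K + K'.choose t ≤ Fintype.card F) :
    Nonempty (LinearDelivery F K K' N (Fin (K'.choose t)) (Fin (cacheSize K K' N t))
      (Fin (signalSize K' N t))) := by
  classical
  set L := K'.choose t with hL
  -- One evaluation node per set of users and `L` spare ones for the key combinations; this fixes
  -- the bound on the field size.
  obtain ⟨α⟩ : Nonempty (Finset (Fin K) ⊕ Fin L ↪ F) :=
    Function.Embedding.nonempty_of_card_le (by simpa using hF)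
  have hIdx : ∀ j : Fin K, Nonempty (Fin (cacheSize K K' N t) ≃
      (Fin N × {T : Finset (Fin K) // T.card = t ∧ j ∈ T}) ⊕ Fin (L - choosePred K t)) :=
    fun j => ⟨Fintype.equivOfCardEq (by
      rw [Fintype.card_sum, Fintype.card_prod, card_powersetCard_mem, Fintype.card_fin,
        Fintype.card_fin, Fintype.card_fin, cacheSize])⟩
  let e := fun j => Classical.choice (hIdx j)
  let ex : Fin (L - choosePred K t) → Fin L := Fin.castLE (Nat.sub_le _ _)
  have hsig : ∀ (I : Finset (Fin K)), I.card = K' → ∀ q : Demands F N I,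
      ∃ s : Fin (signalSize K' N t) → Fin N → Fin L → F,
      ∀ (f : Library F N (Fin L)) (i : {j // j ∈ I}), (∀ k, ∑ n, ∑ l, s k n l * f n l = 0) →
        (∀ T : Finset {j // j ∈ I}, T.card = t → i ∈ T → ∀ n,
          ∑ l : Fin L, α (.inl (T.map (Function.Embedding.subtype _))) ^ (l : ℕ) * f n l = 0) →
        ∀ T : Finset {j // j ∈ I}, T.card = t →
          ∑ l : Fin L, α (.inl (T.map (Function.Embedding.subtype _))) ^ (l : ℕ) *
            linComb (q i) f l = 0 := by
    intro I hI q
    have h := exists_multicast (ι := {j // j ∈ I}) (L := L) t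
      (fun T l => α (.inl (T.map (Function.Embedding.subtype _))) ^ (l : ℕ)) q
    rwa [Fintype.card_coe, hI] at h
  choose s hs using hsig
  refine ⟨⟨fun j p k n l => Sum.elim
    (fun x => if n = x.1 then α (.inl x.2.1) ^ (l : ℕ) else 0)
    (fun x => p n * α (.inr (ex x)) ^ (l : ℕ)) (e j k), s, ?_⟩⟩
  intro I hI q i p f hcache hsignal
  have hfile : ∀ T : Finset (Fin K), T.card = t → i.1 ∈ T → ∀ n,
      ∑ l : Fin L, α (.inl T) ^ (l : ℕ) * f n l = 0 := by
    intro T hT hi n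
    have h := hcache ((e i.1).symm (.inl (n, ⟨T, hT, hi⟩)))
    simp only [Equiv.apply_symm_apply, Sum.elim_inl] at h
    rwa [Fintype.sum_eq_single n (fun n' hn => Finset.sum_eq_zero fun l _ => by
      rw [if_neg hn, zero_mul]), Finset.sum_congr rfl fun l _ => by rw [if_pos rfl]] at h
  -- The cached coded subfiles give `⟨p, f⟩` at `choosePred K t` nodes, and the extra symbols supply
  -- the missing ones. Truncated subtraction covers the case where none are missing.
  have hkey : linComb p f = 0 := by
    refine eq_zero_of_forall_sum_pow_mul_eq_zero
      (κ := {T : Finset (Fin K) // T.card = t ∧ i.1 ∈ T} ⊕ Fin (L - choosePred K t))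
      (x := fun k => α (Sum.map Subtype.val ex k)) ?_ ?_ _ ?_
    · exact α.injective.comp (Sum.map_injective.2 ⟨Subtype.val_injective,
        Fin.castLE_injective _⟩)
    · rw [Fintype.card_sum, card_powersetCard_mem, Fintype.card_fin]
      omega
    · rintro (T | x)
      · simp only [Sum.map_inl, linComb, Finset.mul_sum]
        rw [Finset.sum_comm]
        refine Finset.sum_eq_zero fun n _ => ?_
        rw [← mul_zero (p n), ← hfile T.1 T.2.1 T.2.2 n, Finset.mul_sum]
        exact Finset.sum_congr rfl fun l _ => by ring
      · have h := hcache ((e i.1).symm (.inr x))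
        simp only [Equiv.apply_symm_apply, Sum.elim_inr] at h
        simp only [Sum.map_inr, linComb, Finset.mul_sum]
        rw [Finset.sum_comm, ← h]
        exact Finset.sum_congr rfl fun n _ => Finset.sum_congr rfl fun l _ => by ring
  -- The active set has exactly `L` subsets of size `t`, just enough nodes.
  have hshift : linComb (q i) f = 0 := by
    refine eq_zero_of_forall_sum_pow_mul_eq_zero
      (κ := {T : Finset {j // j ∈ I} // T.card = t})
      (x := fun T => α (.inl (T.1.map (Function.Embedding.subtype _)))) ?_ ?_ _ ?_
    · intro T T' h
      exact Subtype.ext (Finset.map_injective _ (Sum.inl_injective (α.injective h)))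
    · rw [Fintype.card_finset_len, Fintype.card_coe, hI]
    · rintro ⟨T, hT⟩
      refine hs I hI q f i hsignal (fun T hT hi => hfile _ (by rw [Finset.card_map, hT]) ?_) T hT
      exact Finset.mem_map_of_mem _ hi
  rw [linComb_sub, hshift, hkey, sub_zero]

/-! ### Headers, and several deliveries under common keys -/

section SharedScheme

variable {F : Type} [Field F] {K K' N : ℕ}

/-- The symbols of a cache that do not depend on the files: the key. -/
def cacheHeader (K : ℕ) (p : Fin N → F) (r : Fin (K * (N + 1))) : F :=
  -- All `K` blocks repeat the key after a padding `0`, to match the length of a signal header.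
  Fin.cons (α := fun _ => F) 0 p (finProdFinEquiv.symm r).2

/-- The symbols of a signal that do not depend on the files: the active set and the shifted
demands. -/
def signalHeader (I : Finset (Fin K)) (q : Demands F N I) (r : Fin (K * (N + 1))) : F :=
  if h : (finProdFinEquiv.symm r).1 ∈ I then
    Fin.cons (α := fun _ => F) 1 (q ⟨_, h⟩) (finProdFinEquiv.symm r).2 else 0

theorem signalHeader_injective {I I' : Finset (Fin K)} {q : Demands F N I} {q' : Demands F N I'}
    (h : signalHeader I q = signalHeader I' q') : I = I' ∧ HEq q q' := by
  have hr : ∀ k r, (if h : k ∈ I then Fin.cons (α := fun _ => F) 1 (q ⟨k, h⟩) r else 0) =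
      if h : k ∈ I' then Fin.cons (α := fun _ => F) 1 (q' ⟨k, h⟩) r else 0 := by
    intro k r
    have := congrFun h (finProdFinEquiv (k, r))
    simpa only [signalHeader, Equiv.symm_apply_apply] using this
  -- The leading entry of block `k` is `1` or `0` according to whether `k` is active.
  have hI : I = I' := by
    ext k
    have := hr k 0
    by_cases h₁ : k ∈ I <;> by_cases h₂ : k ∈ I' <;> simp_all
  subst hI
  refine ⟨rfl, heq_of_eq (funext fun i => funext fun n => ?_)⟩
  have := hr i.1 n.succ
  simpa [i.2] using this

variable [Fintype F] {κ β γ ξ : Type} {b c x : κ → ℕ}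

/-- Files are cut into pieces indexed by `κ`, to each of which a linear delivery is applied, with
common keys and headers. -/
noncomputable def sharedScheme
    (D : ∀ s, LinearDelivery F K K' N (Fin (b s)) (Fin (c s)) (Fin (x s)))
    (eβ : β ≃ Σ s, Fin (b s)) (eγ : γ ≃ Fin (K * (N + 1)) ⊕ Σ s, Fin (c s))
    (eξ : ξ ≃ Fin (K * (N + 1)) ⊕ Σ s, Fin (x s)) : Scheme F K K' N β γ ξ :=
  keyScheme
    (fun j p f k => Sum.elim (cacheHeader K p) (fun y => ∑ n, ∑ l,
      (D y.1).cacheCoef j p y.2 n l * f n (eβ.symm ⟨y.1, l⟩)) (eγ k))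
    (fun I hI q f k => Sum.elim (signalHeader I q) (fun y => ∑ n, ∑ l,
      (D y.1).signalCoef I hI q y.2 n l * f n (eβ.symm ⟨y.1, l⟩)) (eξ k))

theorem sharedScheme_isValid [Fintype β] [DecidableEq β] [Fintype γ] [DecidableEq γ] [Fintype ξ]
    [DecidableEq ξ]
    (D : ∀ s, LinearDelivery F K K' N (Fin (b s)) (Fin (c s)) (Fin (x s)))
    (eβ : β ≃ Σ s, Fin (b s)) (eγ : γ ≃ Fin (K * (N + 1)) ⊕ Σ s, Fin (c s))
    (eξ : ξ ≃ Fin (K * (N + 1)) ⊕ Σ s, Fin (x s)) : (sharedScheme D eβ eγ eξ).IsValid := by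
  classical
  set cache : Fin K → (Fin N → F) → Library F N β → γ → F := fun j p f k =>
    Sum.elim (cacheHeader K p) (fun y => ∑ n, ∑ l,
      (D y.1).cacheCoef j p y.2 n l * f n (eβ.symm ⟨y.1, l⟩)) (eγ k) with hcache
  set transmit : ∀ I : Finset (Fin K), I.card = K' → Demands F N I → Library F N β → ξ → F :=
    fun I hI q f k => Sum.elim (signalHeader I q) (fun y => ∑ n, ∑ l,
      (D y.1).signalCoef I hI q y.2 n l * f n (eβ.symm ⟨y.1, l⟩)) (eξ k) with htransmit
  have key : ∀ (I : Finset (Fin K)) (hI : I.card = K') (q : Demands F N I) (f : Library F N β)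
      (i : {j // j ∈ I}) (I' : Finset (Fin K)) (hI' : I'.card = K') (q' : Demands F N I')
      (f' : Library F N β) (i' : {j // j ∈ I'}) (d : Fin N → F), i'.1 = i.1 →
      transmit I' hI' q' f' = transmit I hI q f →
      cache i'.1 (q' i' - d) f' = cache i.1 (q i - d) f → linComb d f' = linComb d f := by
    intro I hI q f i I' hI' q' f' i' d hi hX hZ
    obtain ⟨rfl, hq⟩ := signalHeader_injective (I := I') (I' := I) (q := q') (q' := q) (by
      funext r
      simpa [htransmit] using congrFun hX (eξ.symm (.inl r)))
    obtain rfl := eq_of_heq hq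
    obtain rfl := Subtype.ext hi
    funext s
    obtain ⟨⟨s, l⟩, rfl⟩ := eβ.symm.surjective s
    -- By linearity, decodability is applied to the difference of two libraries with the same
    -- observations.
    have hdec := (D s).decodable I' hI q' i' (q' i' - d)
      (fun n l => f' n (eβ.symm ⟨s, l⟩) - f n (eβ.symm ⟨s, l⟩)) ?_ ?_
    · rw [sub_sub_cancel] at hdec
      have := congrFun hdec l
      rw [← sub_eq_zero]
      refine Eq.trans ?_ this
      simp only [linComb, mul_sub, Finset.sum_sub_distrib]
    · intro k
      have := congrFun hZ (eγ.symm (.inr ⟨s, k⟩))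
      simp only [hcache, Equiv.apply_symm_apply, Sum.elim_inr] at this
      simp only [mul_sub, Finset.sum_sub_distrib, this, sub_self]
    · intro k
      have := congrFun hX (eξ.symm (.inr ⟨s, k⟩))
      simp only [htransmit, Equiv.apply_symm_apply, Sum.elim_inr] at this
      simp only [mul_sub, Finset.sum_sub_distrib, this, sub_self]
  -- The decoder picks any library consistent with `X`, `d` and `Z`; by `key` the answer does not
  -- depend on the choice. The active set is recovered from the header, so one map serves every
  -- active set.
  refine keyScheme_isValid cache transmit (fun j X d Z =>
    if h : ∃ f : Library F N β, ∃ (I : Finset (Fin K)) (hI : I.card = K') (q : Demands F N I)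
      (i : {j // j ∈ I}), i.1 = j ∧ transmit I hI q f = X ∧ cache i.1 (q i - d) f = Z
    then linComb d h.choose else 0) ?_
  intro I hI q f i d
  have h : ∃ f' : Library F N β, ∃ (I' : Finset (Fin K)) (hI' : I'.card = K')
      (q' : Demands F N I') (i' : {j // j ∈ I'}), i'.1 = i.1 ∧
      transmit I' hI' q' f' = transmit I hI q f ∧
      cache i'.1 (q' i' - d) f' = cache i.1 (q i - d) f := ⟨f, I, hI, q, i, rfl, rfl, rfl⟩
  rw [dif_pos h]
  obtain ⟨I', hI', q', i', h₁, h₂, h₃⟩ := h.choose_spec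
  exact key I hI q f i I' hI' q' _ i' d h₁ h₂ h₃

/-- A linear delivery as a scheme with the corresponding subpacketization level. -/
noncomputable def LinearDelivery.toPacketScheme {L a b : ℕ}
    (D : LinearDelivery F K K' N (Fin L) (Fin a) (Fin b)) :
    PacketScheme F K K' N L a b (K * (N + 1)) where
  Rand := fun _ => Fin N → F
  randFintype := fun _ => inferInstance
  law := fun _ => PMF.uniformOfFintype (Fin N → F)
  cacheHead := fun _ p => cacheHeader K p
  cacheCoef := D.cacheCoef
  signalHead := fun I _ d τ => signalHeader I fun i => d i + τ i.1
  signalCoef := fun I hI d τ => D.signalCoef I hI fun i => d i + τ i.1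

/-- Pairs as elements of a constant sigma type, indexed by the second component. -/
def prodEquivSigma (α μ : Type) : α × μ ≃ Σ _ : μ, α :=
  (Equiv.prodComm α μ).trans (Equiv.sigmaEquivProd μ α).symm

theorem LinearDelivery.toPacketScheme_isValid {L a b : ℕ}
    (D : LinearDelivery F K K' N (Fin L) (Fin a) (Fin b)) (m : ℕ) :
    (D.toPacketScheme.toScheme m).IsValid := by
  have h : D.toPacketScheme.toScheme m = sharedScheme (fun _ : Fin m => D)
      (prodEquivSigma (Fin L) (Fin m))
      (Equiv.sumCongr (Equiv.refl _) (prodEquivSigma (Fin a) (Fin m)))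
      (Equiv.sumCongr (Equiv.refl _) (prodEquivSigma (Fin b) (Fin m))) := by
    unfold PacketScheme.toScheme sharedScheme keyScheme
    congr 1
    · funext j f p k
      rcases k with r | k <;> rfl
    · funext I hI d f τ k
      rcases k with r | k <;> rfl
  rw [h]
  exact sharedScheme_isValid _ _ _ _

end SharedScheme

/-! ### Memory sharing -/

section Trivial

variable (F : Type) [Field F] (K K' N : ℕ)

theorem linComb_zero_right {β : Type} (d : Fin N → F) : linComb d (0 : Library F N β) = 0 := by
  funext s
  simp [linComb]

/-- All files are cached. -/
def cachedDelivery : LinearDelivery F K K' N (Fin 1) (Fin N) (Fin 0) where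
  cacheCoef := fun _ _ k n _ => if n = k then 1 else 0
  signalCoef := fun _ _ _ _ _ _ => 0
  decodable := by
    intro I hI q i p f hf _
    have : f = 0 := by
      funext n l
      simpa [Subsingleton.elim l 0] using hf n
    rw [this, linComb_zero_right]

/-- All files are transmitted. -/
def uncachedDelivery (b : ℕ) : LinearDelivery F K K' N (Fin b) (Fin 0) (Fin (N * b)) where
  cacheCoef := fun _ _ _ _ _ => 0
  signalCoef := fun _ _ _ k n l => if finProdFinEquiv.symm k = (n, l) then 1 else 0
  decodable := by
    intro I hI q i p f _ hf
    have : f = 0 := by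
      funext n l
      have := hf (finProdFinEquiv (n, l))
      simp only [Equiv.symm_apply_apply, Prod.mk.injEq] at this
      rwa [Fintype.sum_eq_single n (fun n' hn => Finset.sum_eq_zero fun l' _ => by
        rw [if_neg fun h => hn h.1.symm, zero_mul]), Fintype.sum_eq_single l (fun l' hl => by
        rw [if_neg fun h => hl h.2.symm, zero_mul]), if_pos ⟨rfl, rfl⟩, one_mul] at this
    rw [this, linComb_zero_right]

end Trivial

/-- Cut a file into `m i` blocks of length `L i`, in proportions `w i`, and send the remainder
uncoded. The cache bound has no slack `ε`, so the proportions are shrunk by `1 - δ` to make room for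
the header. The condition `L i ≤ A i` gives `M ≥ 1`, so this frees at least `δ * n` cache symbols.
-/
theorem achievable_of_convex_combination {K K' N : ℕ} {ι : Type} [Fintype ι]
    (L A B : ι → ℕ) (hL : ∀ i, 0 < L i) (hA : ∀ i, L i ≤ A i) (q₀ : ℕ)
    (hD : ∀ (F : Type) [Field F] [Fintype F], q₀ ≤ Fintype.card F →
      ∀ i, Nonempty (LinearDelivery F K K' N (Fin (L i)) (Fin (A i)) (Fin (B i))))
    (w : ι → ℝ) (hw : ∀ i, 0 ≤ w i) (hw₁ : ∑ i, w i = 1) :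
    Achievable K K' N (∑ i, w i * (A i / L i)) (∑ i, w i * (B i / L i)) := by
  intro ε hε
  set M : ℝ := ∑ i, w i * (A i / L i)
  set R : ℝ := ∑ i, w i * (B i / L i)
  have hL' : ∀ i, (0 : ℝ) < L i := fun i => Nat.cast_pos.2 (hL i)
  have hM : 1 ≤ M := by
    rw [← hw₁]
    refine Finset.sum_le_sum fun i _ => le_mul_of_one_le_right (hw i) ?_
    rw [one_le_div (hL' i)]
    exact_mod_cast hA i
  have hR : 0 ≤ R := Finset.sum_nonneg fun i _ => mul_nonneg (hw i) (by positivity)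
  -- Sending the uncoded fraction `δ` of all `N` files then costs at most half of `ε`; the other
  -- half pays for the header and for rounding.
  set δ : ℝ := min 1 (ε / (2 * (N + 1)))
  have hδ : 0 < δ := lt_min one_pos (by positivity)
  have hδ₁ : δ ≤ 1 := min_le_left _ _
  have hNδ : N * δ ≤ ε / 2 := by
    have h : δ * (2 * (N + 1)) ≤ ε := (le_div_iff₀ (by positivity)).1 (min_le_right _ _)
    nlinarith
  set h : ℕ := K * (N + 1)
  set C : ℕ := ∑ i, L i
  refine ⟨q₀ + ⌈h / δ⌉₊ + ⌈(h + N * C) / (ε / 2)⌉₊, fun F _ _ hF n hn => ?_⟩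
  have hn₁ : (h : ℝ) ≤ δ * n := by
    rw [← div_le_iff₀' hδ]
    exact (Nat.le_ceil _).trans (Nat.cast_le.2 (by omega))
  have hn₂ : (h + N * C : ℝ) ≤ ε / 2 * n := by
    rw [← div_le_iff₀' (half_pos hε)]
    exact (Nat.le_ceil _).trans (Nat.cast_le.2 (by omega))
  set m : ι → ℕ := fun i => ⌊(1 - δ) * w i * n / L i⌋₊
  have hm_nonneg : ∀ i, 0 ≤ (1 - δ) * w i * n / L i := fun i =>
    div_nonneg (mul_nonneg (mul_nonneg (sub_nonneg.2 hδ₁) (hw i)) n.cast_nonneg) (hL' i).le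
  have hm_le : ∀ i, (m i : ℝ) ≤ (1 - δ) * w i * n / L i := fun i => Nat.floor_le (hm_nonneg i)
  have hm_lt : ∀ i, (1 - δ) * w i * n / L i < m i + 1 := fun i => Nat.lt_floor_add_one _
  have hsum : ∀ G : ι → ℕ, ((∑ i, m i * G i : ℕ) : ℝ) ≤ (1 - δ) * n * ∑ i, w i * (G i / L i) := by
    intro G
    push_cast
    rw [Finset.mul_sum]
    refine Finset.sum_le_sum fun i _ => ?_
    refine (mul_le_mul_of_nonneg_right (hm_le i) (Nat.cast_nonneg _)).trans_eq ?_
    ring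
  have hused : ((∑ i, m i * L i : ℕ) : ℝ) ≤ (1 - δ) * n := by
    refine (hsum L).trans_eq ?_
    rw [Finset.sum_congr rfl fun i _ => by rw [div_self (hL' i).ne', mul_one], hw₁, mul_one]
  have hused' : (1 - δ) * n - C ≤ ((∑ i, m i * L i : ℕ) : ℝ) := by
    have h₁ : (1 - δ) * n = ∑ i, (1 - δ) * n * w i := by
      rw [← Finset.mul_sum, hw₁, mul_one]
    rw [h₁]
    simp only [C]
    push_cast
    rw [← Finset.sum_sub_distrib]
    refine Finset.sum_le_sum fun i _ => ?_
    have h := (div_lt_iff₀ (hL' i)).1 (hm_lt i)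
    nlinarith
  have hle : ∑ i, m i * L i ≤ n := by
    have : ((∑ i, m i * L i : ℕ) : ℝ) ≤ n :=
      hused.trans (mul_le_of_le_one_left n.cast_nonneg (by linarith))
    exact_mod_cast this
  -- The uncoded remainder: the fraction `δ` and less than one block per index `i` lost to the
  -- floors.
  set r : ℕ := n - ∑ i, m i * L i
  have hr : (r : ℝ) ≤ δ * n + C := by
    simp only [r]
    rw [Nat.cast_sub hle]
    linarith
  have D := fun i => Classical.choice (hD F (by omega) i)
  let b' : Option (Σ i, Fin (m i)) → ℕ := fun s => s.elim r fun s => L s.1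
  let c' : Option (Σ i, Fin (m i)) → ℕ := fun s => s.elim 0 fun s => A s.1
  let x' : Option (Σ i, Fin (m i)) → ℕ := fun s => s.elim (N * r) fun s => B s.1
  let D' : ∀ s, LinearDelivery F K K' N (Fin (b' s)) (Fin (c' s)) (Fin (x' s)) := fun s =>
    match s with
    | none => uncachedDelivery F K K' N r
    | some s => D s.1
  have hcard : ∀ (G : ι → ℕ) (g : ℕ),
      Fintype.card (Σ s : Option (Σ i, Fin (m i)), Fin (s.elim g fun s => G s.1)) =
        g + ∑ i, m i * G i := by
    intro G g
    simp only [Fintype.card_sigma, Fintype.card_fin, Fintype.sum_option, Fintype.sum_sigma]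
    simp
  have eβ : Fin n ≃ Σ s, Fin (b' s) := Fintype.equivOfCardEq (by
    rw [Fintype.card_fin, hcard L r]; omega)
  have eγ : Fin (h + (0 + ∑ i, m i * A i)) ≃ Fin h ⊕ Σ s, Fin (c' s) := Fintype.equivOfCardEq (by
    rw [Fintype.card_sum, Fintype.card_fin, Fintype.card_fin, hcard A 0])
  have eξ : Fin (h + (N * r + ∑ i, m i * B i)) ≃ Fin h ⊕ Σ s, Fin (x' s) :=
    Fintype.equivOfCardEq (by
      rw [Fintype.card_sum, Fintype.card_fin, Fintype.card_fin, hcard B (N * r)])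
  refine ⟨_, _, sharedScheme D' eβ eγ eξ, ?_, ?_, sharedScheme_isValid D' eβ eγ eξ⟩
  · have h₁ := hsum A
    rw [zero_add, Nat.cast_add]
    have h₂ : δ * n ≤ δ * n * M := le_mul_of_one_le_right (by positivity) hM
    linarith
  · have h₁ := hsum B
    have h₂ : (N : ℝ) * r ≤ N * (δ * n + C) := mul_le_mul_of_nonneg_left hr N.cast_nonneg
    have h₃ : N * δ * n ≤ ε / 2 * n := mul_le_mul_of_nonneg_right hNδ n.cast_nonneg
    have h₄ : 0 ≤ δ * n * R := by positivity
    push_cast at h₁ ⊢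
    linarith

/-! ### Corner points and their convex envelope -/

theorem cast_cacheSize (K K' N t : ℕ) (ht : t ≤ K') :
    (cacheSize K K' N t : ℝ) = memNew K K' N t * K'.choose t := by
  have h : (K'.choose t : ℝ) ≠ 0 := Nat.cast_ne_zero.2 (Nat.choose_pos ht).ne'
  rw [memNew, div_mul_cancel₀ _ h, cacheSize]
  push_cast
  congr 1
  rcases le_total (choosePred K t) (K'.choose t) with h | h
  · rw [Nat.cast_sub h, max_eq_left (sub_nonneg.2 (Nat.cast_le.2 h))]
  · rw [Nat.sub_eq_zero_of_le h, Nat.cast_zero, max_eq_right (sub_nonpos.2 (Nat.cast_le.2 h))]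

theorem cast_signalSize (K' N t : ℕ) (ht : t ≤ K') :
    (signalSize K' N t : ℝ) = loadNew K' N t * K'.choose t := by
  have h : (K'.choose t : ℝ) ≠ 0 := Nat.cast_ne_zero.2 (Nat.choose_pos ht).ne'
  rw [loadNew, div_mul_cancel₀ _ h, signalSize,
    Nat.cast_sub (Nat.choose_le_choose _ (Nat.sub_le _ _))]

theorem choose_le_cacheSize {N : ℕ} (hN : 0 < N) (K K' t : ℕ) :
    K'.choose t ≤ cacheSize K K' N t := by
  have := Nat.le_mul_of_pos_left (choosePred K t) hN
  unfold cacheSize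
  omega

theorem exists_delivery_of_mem_cornerPoints {K K' N : ℕ} (hN : 0 < N) {p : ℝ × ℝ}
    (hp : p ∈ cornerPoints K K' N) : ∃ L A B : ℕ, 0 < L ∧ L ≤ A ∧
      p = ((A : ℝ) / L, (B : ℝ) / L) ∧
      ∀ (F : Type) [Field F] [Fintype F], 2 ^ K + 2 ^ K' ≤ Fintype.card F →
        Nonempty (LinearDelivery F K K' N (Fin L) (Fin A) (Fin B)) := by
  rcases hp with rfl | ⟨t, ht, rfl⟩
  · exact ⟨1, N, 0, one_pos, hN, by simp, fun F _ _ _ => ⟨cachedDelivery F K K' N⟩⟩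
  · have h : (K'.choose t : ℝ) ≠ 0 := Nat.cast_ne_zero.2 (Nat.choose_pos ht).ne'
    refine ⟨K'.choose t, cacheSize K K' N t, signalSize K' N t, Nat.choose_pos ht,
      choose_le_cacheSize hN K K' t, ?_, fun F _ _ hF => exists_coded_delivery F N t ?_⟩
    · rw [cast_cacheSize K K' N t ht, cast_signalSize K' N t ht, mul_div_cancel_right₀ _ h,
        mul_div_cancel_right₀ _ h]
    · exact (Nat.add_le_add_left (Nat.choose_le_two_pow K' t) _).trans hF

theorem achievable_of_mem_convexHull {K K' N : ℕ} (hN : 0 < N) {M R : ℝ}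
    (h : (M, R) ∈ convexHull ℝ (cornerPoints K K' N)) : Achievable K K' N M R := by
  obtain ⟨ι, _, w, z, hw, hw₁, hz, hsum⟩ := mem_convexHull_iff_exists_fintype.1 h
  choose L A B hL hA hp hD using fun i => exists_delivery_of_mem_cornerPoints hN (hz i)
  have hM : ∑ i, w i * ((A i : ℝ) / L i) = M := by
    refine Eq.trans ?_ (congrArg Prod.fst hsum)
    rw [Prod.fst_sum]
    exact Finset.sum_congr rfl fun i _ => by rw [hp i]; rfl
  have hR : ∑ i, w i * ((B i : ℝ) / L i) = R := by
    refine Eq.trans ?_ (congrArg Prod.snd hsum)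
    rw [Prod.snd_sum]
    exact Finset.sum_congr rfl fun i _ => by rw [hp i]; rfl
  rw [← hM, ← hR]
  exact achievable_of_convex_combination L A B hL hA (2 ^ K + 2 ^ K')
    (fun F _ _ hF i => hD i F hF) w hw hw₁

theorem achievable_lowerConvexEnvelope {K K' N : ℕ} (hN : 0 < N) {M : ℝ}
    (h : ∃ R : ℝ, (M, R) ∈ convexHull ℝ (cornerPoints K K' N)) :
    Achievable K K' N M (lowerConvexEnvelope (cornerPoints K K' N) M) := by
  intro ε hε
  -- A point of the hull within `ε / 2` of the infimum suffices, so the infimum need not be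
  -- attained.
  obtain ⟨y, hy, hlt⟩ := exists_lt_of_csInf_lt
    (s := {y | (M, y) ∈ convexHull ℝ (cornerPoints K K' N)}) h (lt_add_of_pos_right _ (half_pos hε))
  obtain ⟨n₀, hn₀⟩ := achievable_of_mem_convexHull hN hy (ε / 2) (half_pos hε)
  refine ⟨n₀, fun F _ _ hF n hn => ?_⟩
  obtain ⟨c, x, S, hc, hx, hS⟩ := hn₀ F hF n hn
  refine ⟨c, x, S, hc, hx.trans (mul_le_mul_of_nonneg_right ?_ n.cast_nonneg), hS⟩
  rw [lowerConvexEnvelope]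
  linarith

end Hotplug

theorem theorem3 (K K' N : ℕ) (hN : 0 < N) (hK' : 0 < K') (hK : K' ≤ K) :
    (∀ M : ℝ, (∃ R : ℝ, (M, R) ∈ convexHull ℝ (Hotplug.cornerPoints K K' N)) →
      Hotplug.Achievable K K' N M
        (Hotplug.lowerConvexEnvelope (Hotplug.cornerPoints K K' N) M)) ∧
    (∀ t : ℕ, t ≤ K' → ∃ a b h q₀ : ℕ,
      (a : ℝ) = Hotplug.memNew K K' N t * K'.choose t ∧
      (b : ℝ) = Hotplug.loadNew K' N t * K'.choose t ∧
      ∀ (F : Type) [Field F] [Fintype F], q₀ ≤ Fintype.card F →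
        ∃ P : Hotplug.PacketScheme F K K' N (K'.choose t) a b h,
          ∀ m : ℕ, (P.toScheme m).IsValid) := by
  refine ⟨fun M h => Hotplug.achievable_lowerConvexEnvelope hN h, fun t ht => ?_⟩
  refine ⟨Hotplug.cacheSize K K' N t, Hotplug.signalSize K' N t, K * (N + 1),
    2 ^ K + K'.choose t, Hotplug.cast_cacheSize K K' N t ht, Hotplug.cast_signalSize K' N t ht,
    fun F _ _ hF => ?_⟩
  obtain ⟨D⟩ := Hotplug.exists_coded_delivery F N t hF
  exact ⟨D.toPacketScheme, D.toPacketScheme_isValid⟩
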